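/- **Setting.** In the $k$-server problem on the line ($k\ge 1$), a configuration is a vector $s_1\le\dots\le s_k$ of server positions in $\mathbb R$. Starting from an initial configuration $C_0$, requests $r_1,\dots,r_n\in\mathbb R$ arrive one by one, each with a prediction $p_t\in\{1,\dots,k\}$. A deterministic learning-augmented online algorithm $\mathcal A$ chooses, knowing only $C_0$ and the requests and predictions up to time $t$, a configuration $C_t$ that contains $r_t$; its cost on the instance $I$ is $\mathcal A(I)=\sum_t d(C_{t-1},C_t)$ with $d(C,C')=\sum_i|s_i-s'_i|$. $\mathrm{Opt}(I)$ is the optimal offline cost. $\mathrm{FtP}(I)$ is the cost of serving every request by the predicted server, and $\eta=\mathrm{FtP}(I)-\mathrm{Opt}(I)$ is the prediction error. $\mathcal A$ is *$\rho$-consistent* if $\mathcal A(I)\le\rho\,\mathrm{Opt}(I)+c$ for all $I$ with $\eta=0$, and *$\beta$-robust* if $\mathcal A(I)\le\beta\,\mathrm{Opt}(I)+c$ for all $I$ and all predictions, where $c$ depends only on $C_0$. $\mathcal A$ is *memory-constrained* if its next configuration depends only on the current configuration, the request and the prediction, and if for any $k$ distinct points and any starting configuration there is a finite sequence of requests among these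 points after which each of them contains exactly one server. For a block $S'$ of $k'$ consecutive servers, let $I'$ be the following $k'$-server instance: a request of $I$ whose predicted server lies in $S'$ is kept, with its prediction; any other request is replaced by a request at the position, after $\mathcal A$ has served the original request, of the server of $S'$ closest to the predicted one (the end of the block on its side), and that server is predicted. $\mathcal A$ is *locally-consistent* with respect to $\mu:\mathbb N\to\mathbb R$ if for all $I$ and $S'$ the distance travelled by the servers of $S'$ when $\mathcal A$ serves $I$ is at most $\mu(k')\,\mathrm{FtP}(I')+c$, where $c$ is bounded in terms of the initial configuration and, moreover, $c=O(k'\varepsilon)$ if the initial and final configurations of $\mathcal A$ are at distance $\varepsilon$. (In the definitions of consistency and local consistency it suffices to consider instances $I$ on which following the predictions makes no server overtake another.) **Theorem.** Let $\lambda\in(0,1]$, $\rho(m)=\sum_{i=0}^{m-1}\lambda^i$ and $\beta(k)=\sum_{i=0}^{k-1}\lambda^{-i}$. Let $\mathcal A$ be a deterministic learning-augmented online algorithm for the $k$-server problem on the line that is memory-constrained, locally-consistent with respect to $\rho$, and $\rho(k)$-consistent. Then $\mathcal A$ is at least $\beta(k)$-robust: if $\mathcal A$ is $b$-robust for some $b\in\mathbb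 R$, then $b\ge\beta(k)$. -/

import Mathlib

/-!
The `k`-server problem on the line with predictions: deterministic online algorithms, the
algorithm that follows the predictions, the offline optimum, and the notions of consistency,
robustness, memory-constrained algorithms and locally-consistent algorithms.
-/

noncomputable section

namespace KServer

/-- A configuration of `k` servers on the line: positions `s₁ ≤ … ≤ s_k`. -/
abbrev Config (k : ℕ) : Type := Fin k →o ℝ

/-- A request point together with its prediction, the index of the predicted server. -/
abbrev Request (k : ℕ) : Type := ℝ × Fin k

/-- A finite request sequence together with its prediction sequence. -/
abbrev Instance (k : ℕ) : Type := List (Request k)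

/-- The distance travelled by the servers of the index set `S` between two configurations. -/
def moveOn {k : ℕ} (S : Finset (Fin k)) (C C' : Config k) : ℝ := ∑ i ∈ S, |C' i - C i|

/-- The cost `d(C, C')` of moving the servers from `C` to `C'`. As both configurations are sorted,
matching the servers by their rank is a cheapest way to do so. -/
def move {k : ℕ} (C C' : Config k) : ℝ := moveOn Finset.univ C C'

/-- The optimal offline cost of serving the points `rs`, starting in `C₀`: the infimum of the costs
of all schedules `C₀, C₁, …, C_n` with `r_t ∈ C_t` for every `t`. -/
def opt {k : ℕ} (C₀ : Config k) (rs : List ℝ) : ℝ :=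
  sInf {x : ℝ | ∃ S : ℕ → Config k, S 0 = C₀ ∧
    (∀ (t : ℕ) (ht : t < rs.length), ∃ i, S (t + 1) i = rs[t]) ∧
    x = ∑ t ∈ Finset.range rs.length, move (S t) (S (t + 1))}

/-- The cost of following the predictions, `FtP`: each request is served by the predicted server,
which moves there from its previous position. (Removing overtakings by exchanging the roles of two
servers that meet does not change this cost.) -/
def ftpCost {k : ℕ} : (Fin k → ℝ) → Instance k → ℝ
  | _, [] => 0
  | y, (r, p) :: I => |r - y p| + ftpCost (Function.update y p r) I

/-- Following the predictions never makes a server overtake another one. -/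
def NoOvertaking {k : ℕ} : (Fin k → ℝ) → Instance k → Prop
  | y, [] => Monotone y
  | y, (r, p) :: I => Monotone y ∧ NoOvertaking (Function.update y p r) I

/-- The prediction error `η = FtP(I) - Opt(I)`. -/
def predictionError {k : ℕ} (C₀ : Config k) (I : Instance k) : ℝ :=
  ftpCost C₀ I - opt C₀ (I.map Prod.fst)

/-- A learning-augmented deterministic online algorithm: `conf C₀ I` is its configuration after it
has served the requests `I` (with their predictions) starting in `C₀`. -/
structure OnlineAlgorithm (k : ℕ) where
  conf : Config k → Instance k → Config k
  conf_nil : ∀ C₀, conf C₀ [] = C₀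
  serves : ∀ (C₀ : Config k) (I : Instance k) (r : ℝ) (p : Fin k),
    ∃ i, conf C₀ (I ++ [(r, p)]) i = r

namespace OnlineAlgorithm

variable {k : ℕ} (A : OnlineAlgorithm k)

/-- The total distance travelled by the servers of the index set `S` when `A` serves `I`. -/
def costOn (S : Finset (Fin k)) (C₀ : Config k) (I : Instance k) : ℝ :=
  ∑ t ∈ Finset.range I.length, moveOn S (A.conf C₀ (I.take t)) (A.conf C₀ (I.take (t + 1)))

/-- The total cost of `A` on `I`, started in `C₀`. -/
def cost (C₀ : Config k) (I : Instance k) : ℝ := A.costOn Finset.univ C₀ I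

/-- `A` is `ρ`-consistent: it is `ρ`-competitive, up to an additive constant depending only on the
initial configuration, on the instances with prediction error `0`. -/
def IsConsistent (ρ : ℝ) : Prop :=
  ∃ c : Config k → ℝ, ∀ (C₀ : Config k) (I : Instance k), NoOvertaking C₀ I →
    predictionError C₀ I = 0 → A.cost C₀ I ≤ ρ * opt C₀ (I.map Prod.fst) + c C₀

/-- `A` is `β`-robust: it is `β`-competitive, up to an additive constant depending only on the
initial configuration, whatever the predictions are. -/
def IsRobust (β : ℝ) : Prop :=
  ∃ c : Config k → ℝ, ∀ (C₀ : Config k) (I : Instance k),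
    A.cost C₀ I ≤ β * opt C₀ (I.map Prod.fst) + c C₀

/-- `A` is memory-constrained: its next configuration depends only on its current configuration,
the request and the prediction; and its memory can be erased: for any `k` distinct points and any
starting configuration, some finite sequence of requests among these points makes `A` place
exactly one server on each of them. -/
def IsMemoryConstrained : Prop :=
  (∃ next : Config k → ℝ → Fin k → Config k, ∀ (C₀ : Config k) (I : Instance k) (r : ℝ)
    (p : Fin k), A.conf C₀ (I ++ [(r, p)]) = next (A.conf C₀ I) r p) ∧
  ∀ q : Config k, StrictMono q → ∀ C : Config k,
    ∃ I : Instance k, (∀ x ∈ I, x.1 ∈ Set.range q) ∧ A.conf C I = q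

/-- The server among the consecutive servers `a, …, b` that is closest to server `p`: this is `p`
itself if `a ≤ p ≤ b`, and otherwise the end of the block on the side of `p`. -/
def nearestIn (a b p : Fin k) : Fin k := max a (min p b)

/-- The sub-instance `I'` for the consecutive servers `a, …, b` (with `a ≤ b`), given the run of
`A` on `I`. A request whose predicted server is one of them is kept. Any other request is replaced
by a request at the position, after `A` served the request, of the closest of these servers, and
this server is predicted. Only the servers `a, …, b` are ever used to follow its predictions. -/
def subInstance (C₀ : Config k) (I : Instance k) (a b : Fin k) : Instance k :=
  I.mapIdx fun t x =>
    if x.2 ∈ Finset.Icc a b then x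
    else (A.conf C₀ (I.take (t + 1)) (nearestIn a b x.2), nearestIn a b x.2)

/-- `A` is locally-consistent with respect to `μ`: for every block of `k'` consecutive servers,
the cost of `A` restricted to the block is at most `μ k' * FtP(I') + e`, where the additive term
`e` is bounded in terms of the initial configuration, and moreover is at most a constant times
`k' * ε` if the initial and the final configuration are at distance `ε`. -/
def IsLocallyConsistent (μ : ℕ → ℝ) : Prop :=
  ∃ (c : Config k → ℝ) (K : ℝ), ∀ (C₀ : Config k) (I : Instance k), NoOvertaking C₀ I →
    ∀ a b : Fin k, a ≤ b → ∃ e : ℝ,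
      A.costOn (Finset.Icc a b) C₀ I
        ≤ μ (Finset.Icc a b).card * ftpCost C₀ (A.subInstance C₀ I a b) + e ∧
      e ≤ c C₀ ∧ e ≤ K * (Finset.Icc a b).card * move C₀ (A.conf C₀ I)

end OnlineAlgorithm

end KServer

end

noncomputable section

namespace KServer

variable {k : ℕ}

/-! The adversary uses `k + 1` points `X 0 < … < X k` whose gaps grow by a factor `L`, and always
requests a point at distance at least `1` from every server, so the cost grows with time. The
offline optimum can keep servers on `X 0, …, X (k - 1)` and make an excursion only for a request at
`X k`. The last online server must make that same trip at each such request, so its own travel is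
already about the optimum (`visits_le_travel`, `exists_opt_adversary_le`).

Local consistency then forces the other servers to travel too. On the block of the last `m + 1`
servers, all but the first of them are predicted for the points where they already stand, and the
first one in effect chases the corresponding online server. So FtP costs hardly more than the travel
of this one server (`ftpCost_subInstance_le`). With `U m` the travel of the last `m` servers, this
reads `U (m + 1) ≤ ρ (m + 1) * (U (m + 1) - U m)` up to errors. Since `ρ (m + 1) = 1 + λ * ρ m`, the
total is at least `ρ k / λ ^ (k - 1) = β k` times `U 1` (`geom_sum_mul_le_of_suffix_le`).

The errors come from requests that the predicted server does not reach. Each is followed by a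
request above a gap at least `L` times longer, so together they are `O(1 / L)` of the cost
(`missed_le`) and vanish as `L → ∞`. -/

lemma moveOn_nonneg (S : Finset (Fin k)) (C D : Config k) : 0 ≤ moveOn S C D :=
  Finset.sum_nonneg fun _ _ => abs_nonneg _

lemma move_nonneg (C D : Config k) : 0 ≤ move C D := moveOn_nonneg _ C D

lemma move_self (C : Config k) : move C C = 0 := by simp [move, moveOn]

lemma move_comm (C D : Config k) : move C D = move D C := by
  simp only [move, moveOn, abs_sub_comm]

lemma move_triangle (C D E : Config k) : move C E ≤ move C D + move D E := by
  unfold move moveOn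
  rw [← Finset.sum_add_distrib]
  refine Finset.sum_le_sum fun i _ => ?_
  have := abs_sub_le (E i) (D i) (C i)
  linarith

lemma abs_le_move (C D : Config k) (i : Fin k) : |D i - C i| ≤ move C D :=
  Finset.single_le_sum (f := fun i => |D i - C i|) (fun _ _ => abs_nonneg _) (Finset.mem_univ i)

/-! ### Bounds on the offline optimum. -/

lemma opt_nonneg (C₀ : Config k) (rs : List ℝ) : 0 ≤ opt C₀ rs := by
  refine Real.sInf_nonneg ?_
  rintro x ⟨S, -, -, rfl⟩
  exact Finset.sum_nonneg fun _ _ => move_nonneg _ _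

lemma opt_le_schedule {C₀ : Config k} {rs : List ℝ} (S : ℕ → Config k) (h0 : S 0 = C₀)
    (hs : ∀ (t : ℕ) (ht : t < rs.length), ∃ i, S (t + 1) i = rs[t]) :
    opt C₀ rs ≤ ∑ t ∈ Finset.range rs.length, move (S t) (S (t + 1)) := by
  refine csInf_le ⟨0, ?_⟩ ⟨S, h0, hs, rfl⟩
  rintro x ⟨S, -, -, rfl⟩
  exact Finset.sum_nonneg fun _ _ => move_nonneg _ _

/-- If every request is served by the configuration `B` or by the configuration `B'`, one can stay
in `B` and make an excursion to `B'` whenever this is needed. -/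
lemma opt_le_excursions (C₀ B B' : Config k) (rs : List ℝ) (P : ℕ → Prop) [DecidablePred P]
    (hs : ∀ (t : ℕ) (ht : t < rs.length), ∃ i, (if P t then B' else B) i = rs[t]) :
    opt C₀ rs ≤ move C₀ B
      + 2 * move B B' * ∑ t ∈ Finset.range rs.length, if P t then (1 : ℝ) else 0 := by
  let S : ℕ → Config k := fun t => Nat.casesOn t C₀ fun t => if P t then B' else B
  refine (opt_le_schedule S rfl hs).trans ?_
  -- The way back to `B` is charged in advance, so each excursion pays for both directions at once.
  suffices h : ∀ n, ∑ t ∈ Finset.range n, move (S t) (S (t + 1)) + move (S n) B ≤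
      move C₀ B + 2 * move B B' * ∑ t ∈ Finset.range n, if P t then (1 : ℝ) else 0 by
    have := h rs.length
    have := move_nonneg (S rs.length) B
    linarith
  intro n
  induction n with
  | zero => simp [S]
  | succ n ih =>
    rw [Finset.sum_range_succ, Finset.sum_range_succ]
    have h1 : S (n + 1) = if P n then B' else B := rfl
    rw [h1]
    split_ifs with hP
    · have := move_triangle (S n) B B'
      have := move_comm B B'
      linarith
    · rw [move_self]
      linarith

/-! ### Following predictions when a request is appended. -/

/-- The positions of the servers after following the predictions. -/
def ftpPos (y : Fin k → ℝ) (I : Instance k) : Fin k → ℝ :=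
  I.foldl (fun y x => Function.update y x.2 x.1) y

lemma ftpPos_concat (y : Fin k → ℝ) (I : Instance k) (x : Request k) :
    ftpPos y (I ++ [x]) = Function.update (ftpPos y I) x.2 x.1 := by
  simp [ftpPos]

lemma ftpCost_concat (y : Fin k → ℝ) (I : Instance k) (x : Request k) :
    ftpCost y (I ++ [x]) = ftpCost y I + |x.1 - ftpPos y I x.2| := by
  induction I generalizing y with
  | nil => simp [ftpCost, ftpPos]
  | cons z I ih => simp [ftpCost, ih, ftpPos, add_assoc]

lemma noOvertaking_concat {y : Fin k → ℝ} {I : Instance k} {x : Request k}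
    (hI : NoOvertaking y I) (hx : Monotone (ftpPos y (I ++ [x]))) :
    NoOvertaking y (I ++ [x]) := by
  induction I generalizing y with
  | nil => exact ⟨hI, by simpa [ftpPos, NoOvertaking] using hx⟩
  | cons z I ih => exact ⟨hI.1, ih hI.2 (by simpa [ftpPos] using hx)⟩

namespace OnlineAlgorithm

variable (A : OnlineAlgorithm k)

/-- A replaced request depends only on the prefix up to its own time, so later requests do not alter
it. -/
lemma subInstance_concat (C₀ : Config k) (I : Instance k) (x : Request k) (a b : Fin k) :
    A.subInstance C₀ (I ++ [x]) a b = A.subInstance C₀ I a b ++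
      [if x.2 ∈ Finset.Icc a b then x
        else (A.conf C₀ (I ++ [x]) (nearestIn a b x.2), nearestIn a b x.2)] := by
  unfold subInstance
  rw [List.mapIdx_append]
  congr 1
  · refine List.ext_getElem (by simp) fun t h₁ h₂ => ?_
    have : t + 1 ≤ I.length := by simpa using h₁
    simp only [List.getElem_mapIdx]
    rw [List.take_append_of_le_length this]
  · simp [List.take_of_length_le]

end OnlineAlgorithm

/-! ### The adversary. -/

/-- The number of the point that is requested when the configuration is `C`: it is `i + 1` for the
last server `i` that is not to the right of the point `X i`, up to a tolerance of `1`. -/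
def level (X : ℕ → ℝ) (C : Config k) : ℕ :=
  (Finset.univ.filter fun i : Fin k => C i ≤ X i + 1).sup fun i => (i : ℕ) + 1

lemma level_le (X : ℕ → ℝ) (C : Config k) : level X C ≤ k :=
  Finset.sup_le fun i _ => i.2

lemma lt_of_level_le {X : ℕ → ℝ} {C : Config k} {i : Fin k} (h : level X C ≤ i) :
    X i + 1 < C i := by
  by_contra! hi
  have := Finset.le_sup (f := fun i : Fin k => (i : ℕ) + 1)
    (Finset.mem_filter (p := fun i : Fin k => C i ≤ X i + 1).2 ⟨Finset.mem_univ i, hi⟩)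
  have : (i : ℕ) + 1 ≤ level X C := this
  omega

lemma le_of_level_eq {X : ℕ → ℝ} {C : Config k} {i : Fin k} (h : level X C = i + 1) :
    C i ≤ X i + 1 := by
  have hne : (Finset.univ.filter fun i : Fin k => C i ≤ X i + 1).Nonempty := by
    by_contra hne
    rw [Finset.not_nonempty_iff_eq_empty] at hne
    simp [level, hne] at h
  obtain ⟨j, hj, hj'⟩ := Finset.exists_mem_eq_sup _ hne fun i : Fin k => (i : ℕ) + 1
  have : level X C = j + 1 := hj'
  have : j = i := Fin.ext (by omega)
  subst this
  exact (Finset.mem_filter.1 hj).2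

lemma lt_level {X : ℕ → ℝ} {C : Config k} {i : Fin k} (h : C i ≤ X i + 1) :
    (i : ℕ) < level X C := by
  by_contra! hi
  exact absurd (lt_of_level_le hi) (not_lt.2 h)

/-- The server that is predicted for a request at the point number `h`. -/
def servant (hk : 0 < k) (h : ℕ) : Fin k := ⟨min (h - 1) (k - 1), by omega⟩

namespace OnlineAlgorithm

variable (A : OnlineAlgorithm k) (hk : 0 < k) (X : ℕ → ℝ) (C₀ : Config k)

/-- The requests of the adversary, together with the predictions. -/
def adversary : ℕ → Instance k
  | 0 => []
  | t + 1 => adversary t ++ [(X (level X (A.conf C₀ (adversary t))),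
      servant hk (level X (A.conf C₀ (adversary t))))]

/-- The configuration of `A` after `t` requests of the adversary. -/
def run (t : ℕ) : Config k := A.conf C₀ (A.adversary hk X C₀ t)

/-- The number of the point requested by the adversary at time `t`. -/
def runLevel (t : ℕ) : ℕ := level X (A.run hk X C₀ t)

/-- The distance travelled by server `i` during the first `T` requests of the adversary. -/
def travel (i : Fin k) (T : ℕ) : ℝ :=
  ∑ t ∈ Finset.range T, |A.run hk X C₀ (t + 1) i - A.run hk X C₀ t i|

/-- The number of requests of the adversary at the point number `j` before time `T`. -/
def visits (j T : ℕ) : ℝ :=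
  ∑ t ∈ Finset.range T, if A.runLevel hk X C₀ t = j then (1 : ℝ) else 0

/-- The sum of the lengths of the gaps below the requests that server `i` was meant to serve but
did not reach. -/
def missed (i : Fin k) (T : ℕ) : ℝ :=
  ∑ t ∈ Finset.range T,
    if A.runLevel hk X C₀ t = i + 1 ∧ A.run hk X C₀ (t + 1) i < X (i + 1) then X (i + 1) - X i else 0

lemma adversary_succ (t : ℕ) : A.adversary hk X C₀ (t + 1) = A.adversary hk X C₀ t ++
    [(X (A.runLevel hk X C₀ t), servant hk (A.runLevel hk X C₀ t))] := rfl

lemma run_zero : A.run hk X C₀ 0 = C₀ := A.conf_nil C₀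

lemma run_serves (t : ℕ) : ∃ i, A.run hk X C₀ (t + 1) i = X (A.runLevel hk X C₀ t) :=
  A.serves C₀ _ _ _

@[simp]
lemma length_adversary (T : ℕ) : (A.adversary hk X C₀ T).length = T := by
  induction T with
  | zero => rfl
  | succ T ih => simp [adversary_succ, ih]

lemma take_adversary {t T : ℕ} (h : t ≤ T) :
    (A.adversary hk X C₀ T).take t = A.adversary hk X C₀ t := by
  induction T, h using Nat.le_induction with
  | base => exact List.take_of_length_le (by simp)
  | succ T h ih => rw [adversary_succ, List.take_append_of_le_length (by simpa using h), ih]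

lemma getElem_adversary {t T : ℕ} (h : t < T) :
    (A.adversary hk X C₀ T)[t]'(by simpa using h) =
      (X (A.runLevel hk X C₀ t), servant hk (A.runLevel hk X C₀ t)) := by
  have h1 := A.take_adversary hk X C₀ (show t + 1 ≤ T from h)
  have h2 : ((A.adversary hk X C₀ T).take (t + 1))[t]'(by simp; omega) =
      (A.adversary hk X C₀ T)[t]'(by simpa using h) := List.getElem_take
  rw [← h2]
  simp only [h1, adversary_succ]
  rw [List.getElem_append_right (by simp)]
  simp

lemma costOn_adversary (S : Finset (Fin k)) (T : ℕ) :
    A.costOn S C₀ (A.adversary hk X C₀ T) = ∑ i ∈ S, A.travel hk X C₀ i T := by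
  unfold costOn travel
  rw [Finset.sum_comm, length_adversary]
  refine Finset.sum_congr rfl fun t ht => ?_
  have ht := Finset.mem_range.1 ht
  rw [take_adversary _ _ _ _ ht.le, take_adversary _ _ _ _ (show t + 1 ≤ T from ht)]
  rfl

/-- A bound on the optimum for the requests of the adversary, for two configurations which together
contain all points. -/
lemma opt_adversary_le (B B' : Config k) (j T : ℕ)
    (hB : ∀ h ≤ k, ∃ i, (if h = j then B' else B) i = X h) :
    opt C₀ ((A.adversary hk X C₀ T).map Prod.fst) ≤
      move C₀ B + 2 * move B B' * A.visits hk X C₀ j T := by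
  have := opt_le_excursions C₀ B B' ((A.adversary hk X C₀ T).map Prod.fst)
    (fun t => A.runLevel hk X C₀ t = j) fun t ht => by
      have ht' : t < T := by simpa using ht
      obtain ⟨i, hi⟩ := hB _ (level_le X (A.run hk X C₀ t))
      refine ⟨i, ?_⟩
      rw [List.getElem_map, getElem_adversary _ _ _ _ ht']
      exact hi
  simpa [visits] using this

/-! ### Travel forced by the adversary. -/

variable {X}

/-- Every request of the adversary is at distance at least `1` from the servers. -/
lemma one_le_move_run (hX : ∀ n, X n + 2 ≤ X (n + 1)) (t : ℕ) :
    1 ≤ move (A.run hk X C₀ t) (A.run hk X C₀ (t + 1)) := by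
  obtain ⟨s, hs⟩ := A.run_serves hk X C₀ t
  refine le_trans ?_ (abs_le_move _ _ s)
  rw [hs]
  have hmono : Monotone X := monotone_nat_of_le_succ fun n => by linarith [hX n]
  -- With `h` the level, servers from `h` on lie to the right of `X h + 1`. The others lie at or to
  -- the left of `X (h - 1) + 1 ≤ X h - 1`.
  by_cases h : A.runLevel hk X C₀ t ≤ s
  · have h1 := lt_of_level_le h
    have h2 := hmono h
    rw [abs_sub_comm]
    exact le_trans (by linarith) (le_abs_self _)
  · obtain ⟨h', hh'⟩ : ∃ h', A.runLevel hk X C₀ t = h' + 1 :=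
      ⟨A.runLevel hk X C₀ t - 1, by omega⟩
    have hlt : h' < k := by
      have : A.runLevel hk X C₀ t ≤ k := level_le _ _
      omega
    have h1 : A.run hk X C₀ t ⟨h', hlt⟩ ≤ X h' + 1 := le_of_level_eq hh'
    have h2 : A.run hk X C₀ t s ≤ A.run hk X C₀ t ⟨h', hlt⟩ :=
      (A.run hk X C₀ t).monotone (Fin.mk_le_mk.2 (by omega))
    rw [hh']
    exact le_trans (by linarith [hX h']) (le_abs_self _)

lemma sum_travel (T : ℕ) : ∑ i, A.travel hk X C₀ i T =
    ∑ t ∈ Finset.range T, move (A.run hk X C₀ t) (A.run hk X C₀ (t + 1)) := by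
  unfold travel
  rw [Finset.sum_comm]
  rfl

lemma le_sum_travel (hX : ∀ n, X n + 2 ≤ X (n + 1)) (T : ℕ) :
    (T : ℝ) ≤ ∑ i, A.travel hk X C₀ i T := by
  rw [sum_travel]
  have := Finset.sum_le_sum fun t (_ : t ∈ Finset.range T) => A.one_le_move_run hk C₀ hX t
  simpa using this

/-- A request that the predicted server does not reach is followed by a request further right. -/
lemma runLevel_lt_of_missed {t : ℕ} {i : Fin k}
    (h : A.runLevel hk X C₀ t = i + 1) (hlt : A.run hk X C₀ (t + 1) i < X (i + 1)) :
    (i : ℕ) + 1 < A.runLevel hk X C₀ (t + 1) := by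
  obtain ⟨s, hs⟩ := A.run_serves hk X C₀ t
  rw [h] at hs
  -- The request was served from further right. As configurations are sorted, server `i + 1` is now
  -- at or left of `X (i + 1)`, which raises the level.
  have his : i < s := by
    by_contra! hsi
    have := (A.run hk X C₀ (t + 1)).monotone hsi
    linarith
  have hi' : (i : ℕ) + 1 < k := by have := s.2; have : (i : ℕ) < s := his; omega
  have : A.run hk X C₀ (t + 1) ⟨i + 1, hi'⟩ ≤ X (i + 1) := by
    rw [← hs]
    exact (A.run hk X C₀ (t + 1)).monotone (Fin.mk_le_mk.2 (by have : (i : ℕ) < s := his; omega))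
  exact lt_level (X := X) (show A.run hk X C₀ (t + 1) ⟨i + 1, hi'⟩ ≤ X (i + 1) + 1 by linarith)

/-- The total length of the gaps below the requested points is bounded by the cost. -/
lemma sum_gap_le {L : ℝ} (hL : 2 ≤ L) (hX : ∀ n, X n + 2 ≤ X (n + 1))
    (hgap : ∀ n m, n < m → L * (X n - X (n - 1)) ≤ X m - X (m - 1)) (T : ℕ)
    (hT : A.runLevel hk X C₀ T = 0) :
    ∑ t ∈ Finset.range (T + 1), (X (A.runLevel hk X C₀ t) - X (A.runLevel hk X C₀ t - 1)) ≤
      4 * ∑ i, A.travel hk X C₀ i T := by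
  -- Truncated subtraction gives `w 0 = 0`; with `hT`, the last term of the sum vanishes.
  set w : ℕ → ℝ := fun n => X n - X (n - 1) with hw
  have hmono : Monotone X := monotone_nat_of_le_succ fun n => by linarith [hX n]
  have hw0 : ∀ n, 0 ≤ w n := fun n => sub_nonneg.2 (hmono (Nat.sub_le n 1))
  -- If the predicted server reaches the point, it moves at least the gap minus `1`, hence at least
  -- half the gap. Otherwise the next gap is at least twice as long. Summing over `t` absorbs half
  -- of the sum into the left side.
  have step : ∀ t, w (A.runLevel hk X C₀ t) ≤
      2 * move (A.run hk X C₀ t) (A.run hk X C₀ (t + 1)) + w (A.runLevel hk X C₀ (t + 1)) / 2 := by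
    intro t
    have hm := move_nonneg (A.run hk X C₀ t) (A.run hk X C₀ (t + 1))
    have hn := hw0 (A.runLevel hk X C₀ (t + 1))
    rcases Nat.eq_zero_or_pos (A.runLevel hk X C₀ t) with h0 | hpos
    · rw [h0]
      simp only [hw, sub_self] at hn ⊢
      linarith
    · obtain ⟨h', hh'⟩ : ∃ h', A.runLevel hk X C₀ t = h' + 1 :=
        ⟨A.runLevel hk X C₀ t - 1, by omega⟩
      have hlt : h' < k := by
        have : A.runLevel hk X C₀ t ≤ k := level_le _ _
        omega
      by_cases hb : A.run hk X C₀ (t + 1) ⟨h', hlt⟩ < X (h' + 1)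
      · have h1 := A.runLevel_lt_of_missed hk C₀ (i := ⟨h', hlt⟩) hh' hb
        have h2 : L * w (A.runLevel hk X C₀ t) ≤ w (A.runLevel hk X C₀ (t + 1)) :=
          hgap _ _ (by rw [hh']; exact h1)
        nlinarith [hw0 (A.runLevel hk X C₀ t)]
      · push Not at hb
        have h1 : A.run hk X C₀ t ⟨h', hlt⟩ ≤ X h' + 1 := le_of_level_eq hh'
        have h2 := (le_abs_self _).trans
          (abs_le_move (A.run hk X C₀ t) (A.run hk X C₀ (t + 1)) ⟨h', hlt⟩)
        have h3 := hX h'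
        rw [hh']
        simp only [hw, Nat.add_sub_cancel] at hn ⊢
        linarith
  have hsum := Finset.sum_le_sum fun t (_ : t ∈ Finset.range T) => step t
  rw [Finset.sum_add_distrib, ← Finset.mul_sum, ← Finset.sum_div, ← sum_travel] at hsum
  have e1 := Finset.sum_range_succ (fun t => w (A.runLevel hk X C₀ t)) T
  have e2 := Finset.sum_range_succ' (fun t => w (A.runLevel hk X C₀ t)) T
  have hwT : w (A.runLevel hk X C₀ T) = 0 := by simp [hT, hw]
  have := hw0 (A.runLevel hk X C₀ 0)
  change ∑ t ∈ Finset.range (T + 1), w (A.runLevel hk X C₀ t) ≤ _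
  linarith

/-- Each missed gap is at most `1 / L` times the gap below the next request, and `sum_gap_le` bounds
the sum of all gaps. -/
lemma missed_le {L : ℝ} (hL : 2 ≤ L) (hX : ∀ n, X n + 2 ≤ X (n + 1))
    (hgap : ∀ n m, n < m → L * (X n - X (n - 1)) ≤ X m - X (m - 1)) (T : ℕ)
    (hT : A.runLevel hk X C₀ T = 0) (i : Fin k) :
    A.missed hk X C₀ i T ≤ 4 * (∑ i, A.travel hk X C₀ i T) / L := by
  have hmono : Monotone X := monotone_nat_of_le_succ fun n => by linarith [hX n]
  rw [le_div_iff₀ (by linarith)]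
  refine le_trans ?_ (A.sum_gap_le hk C₀ hL hX hgap T hT)
  rw [Finset.sum_range_succ', missed, Finset.sum_mul]
  refine le_add_of_le_of_nonneg (Finset.sum_le_sum fun t _ => ?_)
    (sub_nonneg.2 (hmono (Nat.sub_le _ 1)))
  split_ifs with h
  · have := hgap _ _ (A.runLevel_lt_of_missed hk C₀ h.1 h.2)
    rw [Nat.add_sub_cancel] at this
    linarith
  · simpa using hmono (Nat.sub_le _ 1)

/-- The last server has to go back and forth for the requests at the last point. -/
lemma visits_le_travel (hX : ∀ n, X n + 2 ≤ X (n + 1)) (T : ℕ) (i : Fin k) (hi : (i : ℕ) + 1 = k) :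
    (X k - X i - 1) * (2 * A.visits hk X C₀ k T - 1) ≤ A.travel hk X C₀ i T := by
  have hXi := hX i
  rw [hi] at hXi
  -- Progress of the last server across `[X i + 1, X k]`, a 1-Lipschitz potential. A visit to `X k`
  -- starts with `ψ = 0` and ends with `ψ` maximal, so travel and potential each grow by at least
  -- the full length. Only the final return may be missing.
  let ψ : ℝ → ℝ := fun x => min (max x (X i + 1)) (X k) - (X i + 1)
  have hψ0 : ∀ x, 0 ≤ ψ x := fun x =>
    sub_nonneg.2 (le_min (le_max_right _ _) (by linarith))
  have hψ1 : ∀ x, ψ x ≤ X k - X i - 1 := fun x => by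
    have := min_le_right (max x (X i + 1)) (X k)
    simp only [ψ]
    linarith
  have hlip : ∀ x y, ψ x - ψ y ≤ |y - x| := by
    intro x y
    simp only [ψ]
    rcases abs_cases (y - x) with h | h <;>
    rcases max_cases x (X i + 1) with h1 | h1 <;> rcases max_cases y (X i + 1) with h2 | h2 <;>
    rcases min_cases (max x (X i + 1)) (X k) with h3 | h3 <;>
    rcases min_cases (max y (X i + 1)) (X k) with h4 | h4 <;> linarith
  suffices h : ∀ T, 2 * (X k - X i - 1) * A.visits hk X C₀ k T ≤ A.travel hk X C₀ i T
      + ψ (A.run hk X C₀ T i) - ψ (A.run hk X C₀ 0 i) by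
    have := h T
    have := hψ1 (A.run hk X C₀ T i)
    have := hψ0 (A.run hk X C₀ 0 i)
    linarith
  intro T
  induction T with
  | zero => simp [visits, travel]
  | succ T ih =>
    have e1 : A.visits hk X C₀ k (T + 1) = A.visits hk X C₀ k T +
      if A.runLevel hk X C₀ T = k then (1 : ℝ) else 0 := Finset.sum_range_succ _ _
    have e2 : A.travel hk X C₀ i (T + 1) = A.travel hk X C₀ i T +
      |A.run hk X C₀ (T + 1) i - A.run hk X C₀ T i| := Finset.sum_range_succ _ _
    rw [e1, e2]
    split_ifs with h
    · have h1 : A.run hk X C₀ T i ≤ X i + 1 := le_of_level_eq (h.trans hi.symm)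
      obtain ⟨s, hs⟩ := A.run_serves hk X C₀ T
      rw [h] at hs
      have h2 : X k ≤ A.run hk X C₀ (T + 1) i := by
        rw [← hs]
        exact (A.run hk X C₀ (T + 1)).monotone (Fin.mk_le_mk.2 (by have := s.2; omega))
      have h3 : ψ (A.run hk X C₀ T i) = 0 := by
        simp only [ψ]
        rw [max_eq_right h1, min_eq_left (by linarith), sub_self]
      have h4 : ψ (A.run hk X C₀ (T + 1) i) = X k - X i - 1 := by
        simp only [ψ]
        rw [max_eq_left (by linarith), min_eq_right h2]
        ring
      have h5 := le_abs_self (A.run hk X C₀ (T + 1) i - A.run hk X C₀ T i)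
      rw [h3] at ih
      rw [h4]
      linarith
    · have := hlip (A.run hk X C₀ T i) (A.run hk X C₀ (T + 1) i)
      linarith

end OnlineAlgorithm

/-! ### A potential for a server that chases another one. -/

/-- A signed distance on the line, which pays for a server at `y` that follows a server at `x`:
the latter is projected to `[a, ∞)`, and its distance from this half-line is a debt. -/
def chase (a y x : ℝ) : ℝ := |y - max x a| - max (a - x) 0

lemma chase_nonneg {a y x : ℝ} (h : a ≤ x) : 0 ≤ chase a y x := by
  simp [chase, max_eq_right (sub_nonpos.2 h)]

/-- To the left of `a`, the debt exactly cancels the distance to the projection; this lets the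
follower move there at no loss. -/
lemma chase_self (a x : ℝ) : chase a x x = 0 := by
  rcases le_total a x with h | h
  · simp [chase, max_eq_left h, max_eq_right (sub_nonpos.2 h)]
  · rw [chase, max_eq_right h, max_eq_left (sub_nonneg.2 h), abs_of_nonpos (sub_nonpos.2 h)]
    ring

lemma chase_le (a y x x' : ℝ) : chase a y x' ≤ chase a y x + |x' - x| := by
  unfold chase
  rcases le_total a x with h | h <;> rcases le_total a x' with h' | h' <;>
  simp only [h, h', max_eq_left, max_eq_right, sub_nonneg, sub_nonpos] <;>
  rcases abs_cases (x' - x) with h1 | h1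
  all_goals
    have e1 := abs_sub_le y x x'
    have e2 := abs_sub_le y a x'
    have e3 := abs_sub_le y x a
    have e4 := abs_sub_comm x x'
    have e5 := abs_sub_comm a x'
    rcases abs_cases (x' - a) with h2 | h2 <;> rcases abs_cases (x - a) with h3 | h3 <;> linarith

/-- The follower moves to the new position of a server that was to the right of `a`. -/
lemma chase_catch_up {a x : ℝ} (y x' : ℝ) (h : a ≤ x) :
    |x' - y| + chase a x' x' ≤ chase a y x + |x' - x| := by
  rw [chase_self, chase, max_eq_left h, max_eq_right (sub_nonpos.2 h)]
  have := abs_sub_le x' x y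
  have := abs_sub_comm x y
  linarith

/-- The follower moves to `a`, and the other server moves across `a`. -/
lemma chase_left {a x x' : ℝ} (y : ℝ) (h : a ≤ x) (h' : x' ≤ a) :
    |a - y| + chase a a x' ≤ chase a y x + |x' - x| := by
  unfold chase
  rw [max_eq_left h, max_eq_right (sub_nonpos.2 h), max_eq_right h', max_eq_left (sub_nonneg.2 h'),
    sub_self, abs_zero, abs_of_nonpos (show x' - x ≤ 0 by linarith)]
  have := abs_sub_le a x y
  have := abs_sub_comm x y
  have := abs_of_nonpos (show a - x ≤ 0 by linarith)
  linarith

/-- The follower moves to `z`, and the other server moves across `z`. -/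
lemma chase_right {a x x' z : ℝ} (y : ℝ) (haz : a ≤ z) (h : x ≤ z) (h' : z ≤ x') :
    |z - y| + chase a z x' ≤ chase a y x + |x' - x| := by
  unfold chase
  rw [max_eq_left (haz.trans h'), max_eq_right (sub_nonpos.2 (haz.trans h')),
    abs_of_nonpos (show z - x' ≤ 0 by linarith), abs_of_nonneg (show 0 ≤ x' - x by linarith)]
  have e1 := abs_sub_le z (max x a) y
  have e2 := abs_sub_comm y (max x a)
  have e3 := abs_of_nonneg (show 0 ≤ z - max x a from sub_nonneg.2 (max_le h haz))
  rcases le_total a x with hx | hx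
  · rw [max_eq_left hx, max_eq_right (sub_nonpos.2 hx)] at *
    linarith
  · rw [max_eq_right hx, max_eq_left (sub_nonneg.2 hx)] at *
    linarith

/-- The follower moves to `z`, and the other server stays to the left of `z`. -/
lemma chase_miss {a x x' z : ℝ} (y : ℝ) (haz : a ≤ z) (h : x ≤ z) (h' : x' ≤ z) :
    |z - y| + chase a z x' ≤ chase a y x + |x' - x| + 2 * (z - a) := by
  unfold chase
  have e1 := abs_sub_le z (max x a) y
  have e2 := abs_sub_comm y (max x a)
  have e3 := abs_of_nonneg (show 0 ≤ z - max x a from sub_nonneg.2 (max_le h haz))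
  have e4 := abs_of_nonneg (show 0 ≤ z - max x' a from sub_nonneg.2 (max_le h' haz))
  -- Both projections lie in `[a, z]`, so a miss loses at most `2 * (z - a)` however far to the left
  -- the server is. The plain distance `|y - x|` would not give this.
  have e5 := le_max_right x a
  have e6 := le_max_right x' a
  have e7 : max (a - x) 0 ≤ max (a - x') 0 + |x' - x| := by
    have := le_abs_self (x' - x)
    have := abs_nonneg (x' - x)
    have := le_max_left (a - x') 0
    have := le_max_right (a - x') 0
    exact max_le (by linarith) (by linarith)
  linarith

/-! ### The predictions on the whole instance and on suffix blocks. -/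

namespace OnlineAlgorithm

variable (A : OnlineAlgorithm k) (hk : 0 < k) {X : ℕ → ℝ} (C₀ : Config k)

/-- Points `0` and `1` are both assigned to server `0`; every other server is only ever predicted
for the point where it starts. -/
lemma noOvertaking_adversary (hX : Monotone X) (hC : ∀ i : Fin k, C₀ i = X (i + 1)) (T : ℕ) :
    NoOvertaking C₀ (A.adversary hk X C₀ T) := by
  suffices h : NoOvertaking C₀ (A.adversary hk X C₀ T) ∧
      (∀ i : Fin k, 0 < (i : ℕ) → ftpPos C₀ (A.adversary hk X C₀ T) i = X (i + 1)) ∧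
      ftpPos C₀ (A.adversary hk X C₀ T) ⟨0, hk⟩ ≤ X 1 from h.1
  induction T with
  | zero => exact ⟨C₀.monotone, fun i _ => hC i, (hC _).le⟩
  | succ T ih =>
    obtain ⟨h1, h2, h3⟩ := ih
    have hle : A.runLevel hk X C₀ T ≤ k := level_le _ _
    have key : (∀ i : Fin k, 0 < (i : ℕ) →
          ftpPos C₀ (A.adversary hk X C₀ (T + 1)) i = X (i + 1)) ∧
        ftpPos C₀ (A.adversary hk X C₀ (T + 1)) ⟨0, hk⟩ ≤ X 1 := by
      rw [adversary_succ, ftpPos_concat]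
      constructor
      · intro i hi
        rw [Function.update_apply]
        split_ifs with h
        · have : (i : ℕ) = min (A.runLevel hk X C₀ T - 1) (k - 1) := congrArg Fin.val h
          exact congrArg X (by omega)
        · exact h2 i hi
      · rw [Function.update_apply]
        split_ifs with h
        · have : 0 = min (A.runLevel hk X C₀ T - 1) (k - 1) := congrArg Fin.val h
          exact hX (by omega)
        · exact h3
    refine ⟨noOvertaking_concat h1 ?_, key⟩
    change Monotone (ftpPos C₀ (A.adversary hk X C₀ (T + 1)))
    intro i j hij
    rcases Nat.eq_zero_or_pos (j : ℕ) with hj | hj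
    · have : i = j := Fin.ext (by have : (i : ℕ) ≤ j := hij; omega)
      rw [this]
    · rw [key.1 j hj]
      rcases Nat.eq_zero_or_pos (i : ℕ) with hi | hi
      · have : i = ⟨0, hk⟩ := Fin.ext hi
        rw [this]
        exact key.2.trans (hX (by omega))
      · rw [key.1 i hi]
        exact hX (by have : (i : ℕ) ≤ j := hij; omega)

/-- For a block at the right end, following the predictions of the sub-instance costs hardly more
than the distance travelled by the first server of the block. -/
lemma ftpCost_subInstance_le (hX' : ∀ n, X n + 2 ≤ X (n + 1))
    (hC : ∀ i : Fin k, C₀ i = X (i + 1)) (i b : Fin k) (hb : (b : ℕ) + 1 = k) (T : ℕ)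
    (hT : A.runLevel hk X C₀ T = 0) :
    ftpCost C₀ (A.subInstance C₀ (A.adversary hk X C₀ T) i b) ≤
      A.travel hk X C₀ i T + 2 * A.missed hk X C₀ i T := by
  -- The potential may be negative at intermediate times. Level `0` at the end puts server `i` to
  -- the right of `X i`, so that no debt remains.
  suffices h : ∀ T,
      (∀ j, i < j →
        ftpPos C₀ (A.subInstance C₀ (A.adversary hk X C₀ T) i b) j = X (j + 1)) ∧
      ftpCost C₀ (A.subInstance C₀ (A.adversary hk X C₀ T) i b) +
        chase (X i) (ftpPos C₀ (A.subInstance C₀ (A.adversary hk X C₀ T) i b) i)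
          (A.run hk X C₀ T i) ≤ A.travel hk X C₀ i T + 2 * A.missed hk X C₀ i T by
    have h1 := (h T).2
    have h2 : X i + 1 < A.run hk X C₀ T i :=
      lt_of_level_le (show level X (A.run hk X C₀ T) ≤ i from hT.trans_le (Nat.zero_le _))
    have h3 := chase_nonneg (y := ftpPos C₀ (A.subInstance C₀ (A.adversary hk X C₀ T) i b) i)
      (show X i ≤ A.run hk X C₀ T i by linarith)
    linarith
  intro T
  clear hT
  induction T with
  | zero =>
    refine ⟨fun j _ => hC j, ?_⟩
    have : A.subInstance C₀ (A.adversary hk X C₀ 0) i b = [] := rfl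
    rw [this, run_zero]
    simp [ftpCost, ftpPos, travel, missed, chase_self]
  | succ T ih =>
    obtain ⟨ih1, ih2⟩ := ih
    have hle : A.runLevel hk X C₀ T ≤ k := level_le _ _
    have e2 : A.travel hk X C₀ i (T + 1) = A.travel hk X C₀ i T +
      |A.run hk X C₀ (T + 1) i - A.run hk X C₀ T i| := Finset.sum_range_succ _ _
    have e3 : A.missed hk X C₀ i (T + 1) = A.missed hk X C₀ i T +
      if A.runLevel hk X C₀ T = i + 1 ∧ A.run hk X C₀ (T + 1) i < X (i + 1)
        then X (i + 1) - X i else 0 := Finset.sum_range_succ _ _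
    have hrun : A.conf C₀ (A.adversary hk X C₀ T ++
        [(X (A.runLevel hk X C₀ T), servant hk (A.runLevel hk X C₀ T))]) =
        A.run hk X C₀ (T + 1) := rfl
    rw [e2, e3, adversary_succ, subInstance_concat, ftpPos_concat, ftpCost_concat, hrun]
    set I' := A.subInstance C₀ (A.adversary hk X C₀ T) i b
    set h := A.runLevel hk X C₀ T with hh
    set p := servant hk h with hp
    have hpv : (p : ℕ) = min (h - 1) (k - 1) := rfl
    have hXi := hX' i
    have hgap : 0 ≤ X (i + 1) - X i := by linarith
    -- the first server of the block moves
    have first : ∀ z : ℝ,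
        |z - ftpPos C₀ I' i| + chase (X i) z (A.run hk X C₀ (T + 1) i) ≤
          chase (X i) (ftpPos C₀ I' i) (A.run hk X C₀ T i) +
            |A.run hk X C₀ (T + 1) i - A.run hk X C₀ T i| +
            2 * (if h = i + 1 ∧ A.run hk X C₀ (T + 1) i < X (i + 1)
              then X (i + 1) - X i else 0) →
        (∀ j, i < j → Function.update (ftpPos C₀ I') i z j = X (j + 1)) ∧
        ftpCost C₀ I' + |z - ftpPos C₀ I' i| +
          chase (X i) (Function.update (ftpPos C₀ I') i z i) (A.run hk X C₀ (T + 1) i) ≤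
          A.travel hk X C₀ i T + |A.run hk X C₀ (T + 1) i - A.run hk X C₀ T i| +
          2 * (A.missed hk X C₀ i T +
            if h = i + 1 ∧ A.run hk X C₀ (T + 1) i < X (i + 1) then X (i + 1) - X i else 0) := by
      intro z hz
      refine ⟨fun j hj => ?_, ?_⟩
      · rw [Function.update_of_ne hj.ne']
        exact ih1 j hj
      · rw [Function.update_self]
        linarith
    rcases lt_trichotomy h (i + 1) with hlt | heq | hgt
    · have hx : X i + 1 < A.run hk X C₀ T i := lt_of_level_le (Nat.lt_succ_iff.1 hlt)
      have hne : ¬(h = i + 1 ∧ A.run hk X C₀ (T + 1) i < X (i + 1)) := fun h => by omega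
      -- The level is at most `i`, so `p = i` occurs only for server `0` and point `0`. Otherwise
      -- `p` lies to the left of the block, and the replaced request makes the follower catch up
      -- with server `i`.
      by_cases hpi : p = i
      · have hi0 : (i : ℕ) = 0 ∧ h = 0 := by
          have : (i : ℕ) = min (h - 1) (k - 1) := by rw [← hpi, hpv]
          omega
        rw [if_pos (Finset.mem_Icc.2 ⟨hpi.ge, Fin.mk_le_mk.2 (by omega)⟩)]
        simp only [hpi]
        refine first _ ?_
        rw [if_neg hne]
        obtain ⟨s, hs⟩ := A.run_serves hk X C₀ T
        have hx' : A.run hk X C₀ (T + 1) i ≤ X i := by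
          have : X i = X h := by rw [hi0.1, hi0.2]
          rw [this, hh, ← hs]
          exact (A.run hk X C₀ (T + 1)).monotone (Fin.mk_le_mk.2 (by omega))
        have := chase_left (ftpPos C₀ I' i) (show X i ≤ A.run hk X C₀ T i by linarith) hx'
        have hXh : X h = X i := by rw [hi0.1, hi0.2]
        rw [hXh]
        linarith
      · have hpi' : p < i := by
          have : (p : ℕ) ≠ i := fun h => hpi (Fin.ext h)
          exact Fin.mk_lt_mk.2 (by omega)
        have hnear : nearestIn i b p = i :=
          max_eq_left ((min_le_left _ _).trans hpi'.le)
        rw [if_neg fun hm => absurd (Finset.mem_Icc.1 hm).1 (not_le.2 hpi')]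
        simp only [hnear]
        refine first _ ?_
        rw [if_neg hne]
        have := chase_catch_up (ftpPos C₀ I' i) (A.run hk X C₀ (T + 1) i)
          (show X i ≤ A.run hk X C₀ T i by linarith)
        linarith
    · have hpi : p = i := Fin.ext (by have := i.2; omega)
      have hx : A.run hk X C₀ T i ≤ X i + 1 := le_of_level_eq heq
      rw [if_pos (Finset.mem_Icc.2 ⟨hpi.ge, Fin.mk_le_mk.2 (by omega)⟩)]
      simp only [hpi]
      refine first _ ?_
      rw [heq]
      by_cases hm : A.run hk X C₀ (T + 1) i < X (i + 1)
      · rw [if_pos ⟨rfl, hm⟩]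
        exact chase_miss _ (by linarith) (by linarith) hm.le
      · rw [if_neg fun h => hm h.2]
        have := chase_right (ftpPos C₀ I' i) (show X i ≤ X (i + 1) by linarith)
          (show A.run hk X C₀ T i ≤ X (i + 1) by linarith) (not_lt.1 hm)
        linarith
    -- The predicted server already stands on the requested point, so following is free and only the
    -- online server moves.
    · have hpi : i < p := Fin.mk_lt_mk.2 (by have := i.2; omega)
      have hph : (p : ℕ) + 1 = h := by omega
      rw [if_pos (Finset.mem_Icc.2 ⟨hpi.le, Fin.mk_le_mk.2 (by omega)⟩)]
      have hy : X h = ftpPos C₀ I' p := by rw [ih1 p hpi, hph]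
      simp only [hy, Function.update_eq_self, sub_self, abs_zero]
      refine ⟨ih1, ?_⟩
      rw [if_neg fun h => by omega]
      have := chase_le (X i) (ftpPos C₀ I' i) (A.run hk X C₀ T i) (A.run hk X C₀ (T + 1) i)
      linarith

end OnlineAlgorithm

/-! ### The recursion for suffix sums. -/

/-- Comparing every suffix sum with its first term bounds the total from below by the last term. -/
lemma geom_sum_mul_le_of_suffix_le {lam e : ℝ} (h0 : 0 < lam) (h1 : lam ≤ 1) (he : 0 ≤ e)
    {U : ℕ → ℝ} {n : ℕ}
    (h : ∀ m < n, U (m + 1) ≤ (∑ i ∈ Finset.range (m + 1), lam ^ i) * (U (m + 1) - U m) + e) :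
    ∀ m < n, (∑ i ∈ Finset.range (m + 1), lam ^ i) * (U 1 - m * e) ≤ lam ^ m * U (m + 1) := by
  have hρ : ∀ m, 1 ≤ ∑ i ∈ Finset.range (m + 1), lam ^ i := fun m => by
    rw [Finset.sum_range_succ', pow_zero]
    have : 0 ≤ ∑ i ∈ Finset.range m, lam ^ (i + 1) := Finset.sum_nonneg fun i _ => by positivity
    linarith
  intro m
  induction m with
  | zero => simp
  | succ m ih =>
    intro hm
    have ih := ih (by omega)
    have hm := h (m + 1) hm
    have hr : ∑ i ∈ Finset.range (m + 1 + 1), lam ^ i =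
        1 + lam * ∑ i ∈ Finset.range (m + 1), lam ^ i := by
      rw [Finset.sum_range_succ', Finset.mul_sum, add_comm, pow_zero]
      congr 1
      exact Finset.sum_congr rfl fun i _ => by ring
    have hρ1 := hρ m
    have hρ2 := hρ (m + 1)
    set r := ∑ i ∈ Finset.range (m + 1), lam ^ i
    set s := ∑ i ∈ Finset.range (m + 1 + 1), lam ^ i
    have hp0 : 0 ≤ lam ^ m := by positivity
    have hp1 : lam ^ m ≤ 1 := pow_le_one₀ h0.le h1
    -- Since `s = 1 + lam * r`, the hypothesis becomes a lower bound on the growth from `U (m + 1)`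
    -- to `U (m + 2)`. Multiplying by `lam ^ m` and inserting the induction hypothesis leaves a
    -- common factor `r` to cancel.
    have a1 : s * U (m + 1) ≤ lam * r * U (m + 1 + 1) + e := by
      have : s * U (m + 1 + 1) = U (m + 1 + 1) + lam * r * U (m + 1 + 1) := by rw [hr]; ring
      linarith
    have a2 : s * (r * (U 1 - m * e)) ≤ s * (lam ^ m * U (m + 1)) :=
      mul_le_mul_of_nonneg_left ih (by linarith)
    have a3 := mul_le_mul_of_nonneg_left a1 hp0
    have a4 : lam ^ m * e ≤ r * s * e :=
      mul_le_mul_of_nonneg_right (hp1.trans (one_le_mul_of_one_le_of_one_le hρ1 hρ2)) he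
    have a5 : r * (s * (U 1 - ((m + 1 : ℕ) : ℝ) * e)) ≤ r * (lam ^ (m + 1) * U (m + 1 + 1)) := by
      push_cast
      rw [pow_succ]
      linarith
    exact le_of_mul_le_mul_left a5 (by linarith)

lemma geom_sum_le {lam : ℝ} (h0 : 0 < lam) (h1 : lam ≤ 1) (m : ℕ) :
    ∑ i ∈ Finset.range m, lam ^ i ≤ m := by
  have := Finset.sum_le_sum fun i (_ : i ∈ Finset.range m) => pow_le_one₀ (n := i) h0.le h1
  simpa using this

/-! ### The lower bound on the robustness. -/

namespace OnlineAlgorithm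

variable (A : OnlineAlgorithm k) (hk : 0 < k) {X : ℕ → ℝ} (C₀ : Config k)

lemma visits_mono (j : ℕ) : Monotone (A.visits hk X C₀ j) :=
  monotone_nat_of_le_succ fun T => by
    rw [visits, visits, Finset.sum_range_succ]
    refine le_add_of_nonneg_right ?_
    split_ifs <;> norm_num

/-- The adversary returns to the first point again and again. -/
lemma frequently_runLevel_zero {b c : ℝ} (hX : ∀ n, X n + 2 ≤ X (n + 1))
    (hC : ∀ i : Fin k, C₀ i = X (i + 1)) (hb : 0 < b)
    (hrob : ∀ I : Instance k, A.cost C₀ I ≤ b * opt C₀ (I.map Prod.fst) + c) (T₀ : ℕ) :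
    ∃ T, T₀ ≤ T ∧ A.runLevel hk X C₀ T = 0 := by
  have hmono : Monotone X := monotone_nat_of_le_succ fun n => by linarith [hX n]
  by_contra! hno
  let B : Config k := ⟨fun i => if (i : ℕ) = 0 then X 0 else X (i + 1), fun i j hij => by
    have hij : (i : ℕ) ≤ j := hij
    dsimp only
    split_ifs
    · exact le_rfl
    · exact hmono (by omega)
    · omega
    · exact hmono (by omega)⟩
  -- `C₀` covers every point except `X 0`. With boundedly many requests there, the optimum would
  -- stay bounded while the online cost is at least `T`.
  have hopt : ∀ T, opt C₀ ((A.adversary hk X C₀ T).map Prod.fst) ≤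
      move C₀ C₀ + 2 * move C₀ B * A.visits hk X C₀ 0 T := by
    refine fun T => A.opt_adversary_le hk X C₀ C₀ B 0 T fun h hh => ?_
    split_ifs with h0
    · have h1 : B ⟨0, hk⟩ = X 0 := rfl
      exact ⟨⟨0, hk⟩, by rw [h1, h0]⟩
    · refine ⟨⟨h - 1, by omega⟩, ?_⟩
      rw [hC]
      exact congrArg X (by simp; omega)
  have hvis : ∀ T, A.visits hk X C₀ 0 T ≤ T₀ := by
    intro T
    induction T with
    | zero => simp [visits]
    | succ T ih =>
      rcases lt_or_ge T T₀ with h | h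
      · refine (A.visits_mono hk C₀ 0 (show T + 1 ≤ T₀ from h)).trans ?_
        have : A.visits hk X C₀ 0 T₀ ≤ ∑ t ∈ Finset.range T₀, (1 : ℝ) :=
          Finset.sum_le_sum fun t _ => by split_ifs <;> norm_num
        simpa using this
      · rw [visits, Finset.sum_range_succ, if_neg (hno T h), add_zero]
        exact ih
  obtain ⟨T, hT⟩ := exists_nat_gt (b * (2 * move C₀ B * T₀) + c)
  have h1 := hrob (A.adversary hk X C₀ T)
  rw [cost, costOn_adversary] at h1
  have h2 := A.le_sum_travel hk C₀ hX T
  have h3 := hopt T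
  rw [move_self, zero_add] at h3
  have h4 : 2 * move C₀ B * A.visits hk X C₀ 0 T ≤ 2 * move C₀ B * T₀ :=
    mul_le_mul_of_nonneg_left (hvis T) (by linarith [move_nonneg C₀ B])
  have h5 := mul_le_mul_of_nonneg_left (h3.trans h4) hb.le
  linarith

/-- The optimum can serve all points but the last one without moving. -/
lemma exists_opt_adversary_le (hX : Monotone X) : ∃ c, ∀ T,
    opt C₀ ((A.adversary hk X C₀ T).map Prod.fst) ≤
      c + 2 * (X k - X (k - 1)) * A.visits hk X C₀ k T := by
  let B : Config k := ⟨fun i => X i, fun i j hij => hX hij⟩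
  let B' : Config k := ⟨fun i => if (i : ℕ) + 1 = k then X k else X i, fun i j hij => by
    have hij : (i : ℕ) ≤ j := hij
    have := j.2
    dsimp only
    split_ifs
    · exact le_rfl
    · omega
    · exact hX (by omega)
    · exact hX (by omega)⟩
  have hBB' : move B B' = X k - X (k - 1) := by
    rw [move, moveOn, Finset.sum_eq_single ⟨k - 1, by omega⟩]
    · have h1 : B' ⟨k - 1, by omega⟩ = X k := if_pos (Nat.sub_add_cancel hk)
      rw [h1]
      exact abs_of_nonneg (sub_nonneg.2 (hX (by omega)))
    · intro i _ hi
      have h1 : B' i = B i :=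
        if_neg fun h => hi (Fin.ext (show (i : ℕ) = k - 1 by omega))
      rw [h1, sub_self, abs_zero]
    · simp
  refine ⟨move C₀ B, fun T => ?_⟩
  rw [← hBB']
  refine A.opt_adversary_le hk X C₀ B B' k T fun h hh => ?_
  split_ifs with h0
  · exact ⟨⟨k - 1, by omega⟩, (if_pos (Nat.sub_add_cancel hk)).trans (by rw [h0])⟩
  · exact ⟨⟨h, by omega⟩, rfl⟩

/-- The total cost is bounded from below by the distance travelled by the last server. -/
lemma travel_last_le {lam L c : ℝ} (h0 : 0 < lam) (h1 : lam ≤ 1) (hL : 2 ≤ L)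
    (hX : ∀ n, X n + 2 ≤ X (n + 1))
    (hgap : ∀ n m, n < m → L * (X n - X (n - 1)) ≤ X m - X (m - 1))
    (hC : ∀ i : Fin k, C₀ i = X (i + 1)) (hc : 0 ≤ c)
    (hloc : ∀ I : Instance k, NoOvertaking C₀ I → ∀ a b : Fin k, a ≤ b →
      A.costOn (Finset.Icc a b) C₀ I ≤ (∑ i ∈ Finset.range (Finset.Icc a b).card, lam ^ i) *
        ftpCost C₀ (A.subInstance C₀ I a b) + c)
    (b : Fin k) (hb : (b : ℕ) + 1 = k) (T : ℕ) (hT : A.runLevel hk X C₀ T = 0) :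
    (∑ i ∈ Finset.range k, lam ^ i) * (A.travel hk X C₀ b T -
        k * (k * (8 * (∑ i, A.travel hk X C₀ i T) / L) + c)) ≤
      lam ^ (k - 1) * ∑ i, A.travel hk X C₀ i T := by
  have hmono : Monotone X := monotone_nat_of_le_succ fun n => by linarith [hX n]
  set tot := ∑ i, A.travel hk X C₀ i T with htot
  have htot0 : 0 ≤ tot :=
    Finset.sum_nonneg fun i _ => Finset.sum_nonneg fun t _ => abs_nonneg _
  have he : 0 ≤ k * (8 * tot / L) + c := by positivity
  -- Travel of the last `m` servers; consecutive differences are single servers.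
  let U : ℕ → ℝ := fun m => ∑ j : Fin k, if k ≤ j + m then A.travel hk X C₀ j T else 0
  have hU : ∀ m (i : Fin k), (i : ℕ) + m + 1 = k → U (m + 1) - U m = A.travel hk X C₀ i T := by
    intro m i hi
    rw [← Finset.sum_sub_distrib, Finset.sum_eq_single i]
    · rw [if_pos (by omega), if_neg (by omega), sub_zero]
    · intro j _ hj
      have : (j : ℕ) ≠ i := fun h => hj (Fin.ext h)
      by_cases hjm : k ≤ j + m
      · rw [if_pos (by omega), if_pos hjm, sub_self]
      · rw [if_neg (by omega), if_neg hjm, sub_self]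
    · simp
  have hstep : ∀ m < k, U (m + 1) ≤ (∑ i ∈ Finset.range (m + 1), lam ^ i) * (U (m + 1) - U m) +
      (k * (8 * tot / L) + c) := by
    intro m hm
    let i : Fin k := ⟨k - 1 - m, by omega⟩
    have hi : (i : ℕ) + m + 1 = k := by simp only [i]; omega
    have hcard : (Finset.Icc i b).card = m + 1 := by
      rw [Fin.card_Icc]
      omega
    have h2 := hloc _ (A.noOvertaking_adversary hk C₀ hmono hC T) i b
      (Fin.mk_le_mk.2 (by omega))
    rw [costOn_adversary, hcard] at h2
    have h3 : ∑ j ∈ Finset.Icc i b, A.travel hk X C₀ j T = U (m + 1) := by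
      simp only [U]
      rw [← Finset.sum_filter]
      refine Finset.sum_congr (Finset.ext fun j => ?_) fun _ _ => rfl
      simp only [Finset.mem_Icc, Finset.mem_filter, Finset.mem_univ, true_and, Fin.le_def]
      have := j.2
      omega
    rw [h3] at h2
    have h4 := A.ftpCost_subInstance_le hk C₀ hX hC i b hb T hT
    have h5 := A.missed_le hk C₀ hL hX hgap T hT i
    rw [hU m i hi]
    have hr0 : 0 ≤ ∑ i ∈ Finset.range (m + 1), lam ^ i :=
      Finset.sum_nonneg fun i _ => by positivity
    have hrk : ∑ i ∈ Finset.range (m + 1), lam ^ i ≤ k :=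
      (geom_sum_le h0 h1 _).trans (by exact_mod_cast hm)
    have h6 := mul_le_mul_of_nonneg_left h4 hr0
    have h7 : (∑ i ∈ Finset.range (m + 1), lam ^ i) * (2 * A.missed hk X C₀ i T) ≤
        k * (8 * tot / L) := by
      refine (mul_le_mul_of_nonneg_left (b := 2 * A.missed hk X C₀ i T) (c := 8 * tot / L) ?_
        hr0).trans (mul_le_mul_of_nonneg_right hrk (by positivity))
      have : 8 * tot / L = 2 * (4 * tot / L) := by ring
      linarith
    linarith
  have hfin := geom_sum_mul_le_of_suffix_le h0 h1 he hstep (k - 1) (by omega)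
  have hk1 : k - 1 + 1 = k := by omega
  rw [hk1] at hfin
  have hU0 : U 0 = 0 := Finset.sum_eq_zero fun j _ => if_neg (by have := j.2; omega)
  have hU1 : U 1 = A.travel hk X C₀ b T := by
    have := hU 0 b (by omega)
    rwa [hU0, sub_zero] at this
  have hUk : U k = tot := Finset.sum_congr rfl fun j _ => if_pos (by omega)
  rw [hU1, hUk] at hfin
  refine le_trans (mul_le_mul_of_nonneg_left ?_ (Finset.sum_nonneg fun i _ => by positivity)) hfin
  have : ((k - 1 : ℕ) : ℝ) ≤ k := by exact_mod_cast Nat.sub_le k 1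
  have := mul_le_mul_of_nonneg_right this he
  linarith

/-- A nonpositive ratio would bound every cost from a fixed start by a constant, but the adversary
forces cost at least `T`. -/
lemma IsRobust.pos {A : OnlineAlgorithm k} {b : ℝ} (hk : 0 < k) (hrob : A.IsRobust b) : 0 < b := by
  obtain ⟨c, hc⟩ := hrob
  by_contra! hb
  let X : ℕ → ℝ := fun n => 2 * n
  let C₀ : Config k := ⟨fun _ => 0, monotone_const⟩
  obtain ⟨T, hT⟩ := exists_nat_gt (c C₀)
  have h1 := hc C₀ (A.adversary hk X C₀ T)
  rw [cost, costOn_adversary] at h1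
  have h2 := A.le_sum_travel hk (X := X) C₀ (fun n => by simp only [X]; push_cast; linarith) T
  have h3 := mul_nonpos_of_nonpos_of_nonneg hb
    (opt_nonneg C₀ ((A.adversary hk X C₀ T).map Prod.fst))
  linarith

/-- The lower bound given by points whose distances grow by a factor of `L`. -/
lemma robustness_lower_bound {A : OnlineAlgorithm k} (hk : 0 < k) {lam b L : ℝ} (h0 : 0 < lam)
    (h1 : lam ≤ 1)
    (hloc : A.IsLocallyConsistent (fun m => ∑ i ∈ Finset.range m, lam ^ i))
    (hrob : A.IsRobust b) (hL : 2 ≤ L) :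
    (∑ i ∈ Finset.range k, lam ^ i) / lam ^ (k - 1) * (1 - 1 / L - k * (k * (8 * b / L))) ≤ b := by
  have hb := hrob.pos hk
  obtain ⟨c, K, hloc⟩ := hloc
  obtain ⟨c', hrob⟩ := hrob
  let X : ℕ → ℝ := fun n => ∑ m ∈ Finset.range n, L ^ (m + 1)
  have hXs : ∀ n, X (n + 1) = X n + L ^ (n + 1) := fun n => Finset.sum_range_succ _ _
  have hLpow : ∀ n : ℕ, L ≤ L ^ (n + 1) := fun n => le_self_pow₀ (by linarith) (by omega)
  have hX : ∀ n, X n + 2 ≤ X (n + 1) := fun n => by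
    rw [hXs]
    linarith [hLpow n]
  have hmono : Monotone X := monotone_nat_of_le_succ fun n => by linarith [hX n]
  have hgap : ∀ n m, n < m → L * (X n - X (n - 1)) ≤ X m - X (m - 1) := by
    intro n m hnm
    obtain ⟨m, rfl⟩ : ∃ m', m = m' + 1 := ⟨m - 1, by omega⟩
    rw [Nat.add_sub_cancel, hXs, add_sub_cancel_left]
    rcases n with _ | n
    · simpa using by positivity
    · rw [Nat.add_sub_cancel, hXs, add_sub_cancel_left, ← pow_succ']
      exact pow_le_pow_right₀ (by linarith) (by omega)
  let C₀ : Config k := ⟨fun i => X (i + 1), fun i j hij => hmono (Nat.succ_le_succ hij)⟩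
  have hC : ∀ i : Fin k, C₀ i = X (i + 1) := fun _ => rfl
  let l : Fin k := ⟨k - 1, by omega⟩
  have hl : (l : ℕ) + 1 = k := by simp only [l]; omega
  obtain ⟨K₀, hK₀⟩ := A.exists_opt_adversary_le hk C₀ hmono
  set w := X k - X (k - 1) with hw
  have hwL : L ≤ w := by
    have := hXs (k - 1)
    rw [Nat.sub_add_cancel hk] at this
    rw [hw, this, add_sub_cancel_left]
    have := hLpow (k - 1)
    rwa [Nat.sub_add_cancel hk] at this
  set β := (∑ i ∈ Finset.range k, lam ^ i) / lam ^ (k - 1) with hβ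
  have hβ0 : 0 ≤ β := div_nonneg (Finset.sum_nonneg fun i _ => by positivity) (by positivity)
  have key : ∀ T, A.runLevel hk X C₀ T = 0 →
      2 * w * A.visits hk X C₀ k T * (β * (1 - 1 / L - k * (k * (8 * b / L))) - b) ≤
        b * K₀ + c' C₀ + β * (w + k * (k * (8 * (b * K₀ + c' C₀) / L) + |c C₀|)) := by
    intro T hT
    have a1 := hrob C₀ (A.adversary hk X C₀ T)
    rw [cost, costOn_adversary] at a1
    have a2 := mul_le_mul_of_nonneg_left (hK₀ T) hb.le
    have a3 := A.travel_last_le hk C₀ h0 h1 hL hX hgap hC (abs_nonneg (c C₀))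
      (fun I hI p q hpq => by
        obtain ⟨e, he1, he2, -⟩ := hloc C₀ I hI p q hpq
        linarith [le_abs_self (c C₀)]) l hl T hT
    have a4 := A.visits_le_travel hk C₀ hX T l hl
    rw [show X k - X l - 1 = w - 1 from rfl] at a4
    set tot := ∑ i, A.travel hk X C₀ i T
    set n := A.visits hk X C₀ k T
    have hn : 0 ≤ n := Finset.sum_nonneg fun t _ => by split_ifs <;> norm_num
    have a5 : β * (A.travel hk X C₀ l T - k * (k * (8 * tot / L) + |c C₀|)) ≤ tot := by
      rw [hβ, div_mul_eq_mul_div, div_le_iff₀ (by positivity)]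
      linarith
    -- The tolerance `1` is at most the fraction `1 / L` of the last gap, because `L ≤ w`.
    have a6 : 2 * w * n * (1 - 1 / L) - w ≤ A.travel hk X C₀ l T := by
      have : n * 1 ≤ n * (w / L) :=
        mul_le_mul_of_nonneg_left ((one_le_div (by linarith)).2 hwL) hn
      have : 2 * w * n * (1 - 1 / L) = 2 * w * n - 2 * (n * (w / L)) := by ring
      linarith
    -- Robustness turns the error `O(tot / L)` into `O(1 / L)` times the main term `2 * w * n`, up
    -- to a constant.
    have a7 : tot ≤ b * (K₀ + 2 * w * n) + c' C₀ := a1.trans (by linarith)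
    have a8 : (k : ℝ) * (k * (8 * tot / L) + |c C₀|) ≤
        k * (k * (8 * (b * (K₀ + 2 * w * n) + c' C₀) / L) + |c C₀|) := by
      gcongr
    have a9 : β * (2 * w * n * (1 - 1 / L) - w -
        k * (k * (8 * (b * (K₀ + 2 * w * n) + c' C₀) / L) + |c C₀|)) ≤
        b * (K₀ + 2 * w * n) + c' C₀ :=
      (mul_le_mul_of_nonneg_left (by linarith) hβ0).trans (a5.trans a7)
    have e1 : (k : ℝ) * (k * (8 * (b * (K₀ + 2 * w * n) + c' C₀) / L) + |c C₀|) =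
        k * (k * (8 * (b * K₀ + c' C₀) / L) + |c C₀|) + 2 * w * n * (k * (k * (8 * b / L))) := by
      ring
    rw [e1] at a9
    linarith
  -- If `D` is positive, `key` bounds `2 * w * n` by `R / D` at all times of level `0`. This bounds
  -- the optimum and, by robustness, the cost, which contradicts cost at least `T` at arbitrarily
  -- late such times.
  by_contra! hlt
  set D := β * (1 - 1 / L - k * (k * (8 * b / L))) - b with hD
  have hD0 : 0 < D := sub_pos.2 hlt
  set R := b * K₀ + c' C₀ + β * (w + k * (k * (8 * (b * K₀ + c' C₀) / L) + |c C₀|))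
  obtain ⟨T₀, hT₀⟩ := exists_nat_gt (b * (K₀ + R / D) + c' C₀)
  obtain ⟨T, hTT, hT⟩ := A.frequently_runLevel_zero hk C₀ hX hC hb (hrob C₀) T₀
  have b1 := (le_div_iff₀ hD0).2 (key T hT)
  have b2 := hrob C₀ (A.adversary hk X C₀ T)
  rw [cost, costOn_adversary] at b2
  have b3 := A.le_sum_travel hk C₀ hX T
  have b4 := mul_le_mul_of_nonneg_left ((hK₀ T).trans (add_le_add_right b1 K₀)) hb.le
  have b5 : (T₀ : ℝ) ≤ T := by exact_mod_cast hTT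
  linarith

end OnlineAlgorithm

end KServer

end

theorem theorem2 (k : ℕ) (hk : 1 ≤ k) (lam : ℝ) (hlam0 : 0 < lam) (hlam1 : lam ≤ 1)
    (A : KServer.OnlineAlgorithm k) (hmem : A.IsMemoryConstrained)
    (hloc : A.IsLocallyConsistent (fun m => ∑ i ∈ Finset.range m, lam ^ i))
    (hcons : A.IsConsistent (∑ i ∈ Finset.range k, lam ^ i)) :
    ∀ b : ℝ, A.IsRobust b → ∑ i ∈ Finset.range k, lam ^ (-(i : ℤ)) ≤ b := by
  intro b hb
  -- Reversing the order of summation: `lam ^ (k - 1 - i) / lam ^ (k - 1) = lam ^ (-i)`.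
  have hβ : ∑ i ∈ Finset.range k, lam ^ (-(i : ℤ)) =
      (∑ i ∈ Finset.range k, lam ^ i) / lam ^ (k - 1) := by
    rw [← Finset.sum_range_reflect, Finset.sum_div]
    refine Finset.sum_congr rfl fun i hi => ?_
    have hi := Finset.mem_range.1 hi
    rw [zpow_neg, zpow_natCast, eq_div_iff (by positivity), inv_mul_eq_iff_eq_mul₀ (by positivity),
      ← pow_add]
    congr 1
    omega
  rw [hβ]
  have hlim : Filter.Tendsto (fun L : ℝ => (∑ i ∈ Finset.range k, lam ^ i) / lam ^ (k - 1) *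
      (1 - 1 / L - k * (k * (8 * b / L)))) Filter.atTop
      (nhds ((∑ i ∈ Finset.range k, lam ^ i) / lam ^ (k - 1) * (1 - 0 - k * (k * 0)))) :=
    ((tendsto_const_nhds.sub (tendsto_const_nhds.div_atTop Filter.tendsto_id)).sub
      (((tendsto_const_nhds.div_atTop Filter.tendsto_id).const_mul _).const_mul _)).const_mul _
  have hle := le_of_tendsto hlim (Filter.eventually_atTop.2 ⟨2, fun L hL =>
    KServer.OnlineAlgorithm.robustness_lower_bound hk hlam0 hlam1 hloc hb hL⟩)
  simpa using hle
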